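/- Let $n,n',d$ be positive integers. Let $\mathcal P^{n\to n'}$ be the set of channels from $[n]$ to $[n']$, i.e. of column stochastic matrices $\mathbf P=(P(y|x))\in\mathbb R^{n'\times n}$. The signaling polytope $\mathcal C_d^{n\to n'}$ is the set of all $\mathbf P\in\mathcal P^{n\to n'}$ of the form $$P(y|x)=\sum_\lambda q(\lambda)\sum_{m\in[d]}R_\lambda(y|m)\,T_\lambda(m|x),$$ where $q$ is a probability mass function on a finite set and $\mathbf T_\lambda\in\mathcal P^{n\to d}$, $\mathbf R_\lambda\in\mathcal P^{d\to n'}$ for every $\lambda$; these are the channels that can be simulated with $d$ messages and shared randomness. For $0\le k\le n'$, the ambiguous polytope $\mathcal A_{k,d}^{n\to n'}$ is the set of all $\mathbf P\in\mathcal P^{n\to n'}$ such that $\sum_{x,y}G_{y,x}P(y|x)\le d$ for every matrix $\mathbf G\in\mathbb R^{n'\times n}$ that has $k$ rows with entries in $\{0,1\}$ and row sum $1$, and whose remaining $n'-k$ rows have all entries equal to $\frac1{n-d+1}$. The maximum likelihood polytope is $\mathcal M_d^{n\to n'}:=\mathcal A_{n',d}^{n\to n'}$ (for $k=n'$ there are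 no rows of the second kind, so this is meaningful for every $d$). (i) If $d=n'-1$, then $$\mathcal C_d^{n\to n'}=\mathcal M_d^{n\to n'}=\Big\{\mathbf P\in\mathcal P^{n\to n'}:\ \sum_{y=1}^{n'}\max_{x\in[n]}P(y|x)\le d\Big\}.$$ In other words, a channel $\mathbf P\in\mathcal P^{n\to n'}$ lies in $\mathcal C_m^{n\to n'}$ for some $1\le m<n'$ if and only if $\mathbf P\in\mathcal M_{n'-1}^{n\to n'}$. (ii) If $d=n-1$, then $$\mathcal C_d^{n\to n'}=\bigcap_{k=n}^{n'}\mathcal A_{k,d}^{n\to n'},$$ where the intersection is taken inside $\mathcal P^{n\to n'}$ (so it is all of $\mathcal P^{n\to n'}$ if $n'<n$). In other words, a channel $\mathbf P\in\mathcal P^{n\to n'}$ lies in $\mathcal C_m^{n\to n'}$ for some $1\le m<n$ if and only if $\mathbf P\in\mathcal A_{k,n-1}^{n\to n'}$ for all $k=n,\dots,n'$. -/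

import Mathlib

/-- The set of channels with input set `[n]` and output set `[n']`, i.e. the column stochastic
`n' × n` real matrices; the entry `P y x` is the conditional probability `P(y|x)`. -/
def channels (n n' : ℕ) : Set (Matrix (Fin n') (Fin n) ℝ) :=
  {P | (∀ y x, 0 ≤ P y x) ∧ ∀ x, ∑ y, P y x = 1}

/-- The signaling polytope: the channels that can be simulated by sending one of `d` messages with
the help of a shared random variable `l` with probability mass function `q`, where Alice
encodes with `T l` and Bob decodes with `R l`. -/
def signalingPolytope (n n' d : ℕ) : Set (Matrix (Fin n') (Fin n) ℝ) :=
  {P | P ∈ channels n n' ∧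
    ∃ (L : ℕ) (q : Fin L → ℝ) (T : Fin L → Matrix (Fin d) (Fin n) ℝ)
      (R : Fin L → Matrix (Fin n') (Fin d) ℝ),
      (∀ l, 0 ≤ q l) ∧ ∑ l, q l = 1 ∧
      (∀ l, T l ∈ channels n d) ∧ (∀ l, R l ∈ channels d n') ∧
      ∀ y x, P y x = ∑ l, q l * ∑ m, R l y m * T l m x}

/-- The Euclidean inner product of two matrices. -/
def matrixInner {n n' : ℕ} (G P : Matrix (Fin n') (Fin n) ℝ) : ℝ :=
  ∑ x, ∑ y, G y x * P y x

/-- `G` is the matrix of an ambiguous guessing game: `k` of its rows (the guessing rows, indexed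
by `S`) are stochastic with entries in `{0, 1}`, and each of the remaining `n' - k` rows (the
ambiguous rows) has all entries equal to `1 / (n - d + 1)`. -/
def IsAmbiguousGame {n n' : ℕ} (k d : ℕ) (G : Matrix (Fin n') (Fin n) ℝ) : Prop :=
  ∃ S : Finset (Fin n'), S.card = k ∧
    (∀ y ∈ S, (∀ x, G y x = 0 ∨ G y x = 1) ∧ ∑ x, G y x = 1) ∧
    (∀ y ∉ S, ∀ x, G y x = 1 / ((n : ℝ) - (d : ℝ) + 1))

/-- The `(k, d)`-ambiguous polytope: the channels whose score is at most `d` in every ambiguous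
guessing game with `k` guessing rows. -/
def ambiguousPolytope (n n' k d : ℕ) : Set (Matrix (Fin n') (Fin n) ℝ) :=
  {P | P ∈ channels n n' ∧
    ∀ G : Matrix (Fin n') (Fin n) ℝ, IsAmbiguousGame k d G → matrixInner G P ≤ (d : ℝ)}

/-- The maximum likelihood polytope: the case where every row is a guessing row. -/
def mlPolytope (n n' d : ℕ) : Set (Matrix (Fin n') (Fin n) ℝ) :=
  ambiguousPolytope n n' n' d

/-! A channel needs one message fewer once it omits an output (i) or has two equal columns (ii). So
`P` has to be written as a mixture of such channels.

(i) The output `z` is omitted with probability proportional to `1 - max_x P(z|x)`. For each input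
`x`, this law must be coupled with the column `P(·|x)` off the diagonal. By
`exists_isOffDiagCoupling` this is possible as soon as no point has joint mass above the total. The
score bound says that the weights sum to at least 1 before normalization, which ensures this.

(ii) Identifying the inputs `a` and `b` on the output `y` consumes equal mass from `P(y|a)` and
`P(y|b)`, which is a fractional matching of the inputs with capacities `P(y|·)`. Such a matching can
reach half the row sum, or the row sum minus one entry. Summed over `y`, the weight is `n` minus the
score of a game with ambiguous weight `1/(n-d+1) = 1/2`. Scores at most `n - 1` thus give weight at
least 1, and `mem_signalingPolytope_of_matching` builds the mixture. Games with fewer than `n`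
guessing rows come for free by averaging (`gameScore_half_le`).

Conversely, for (i) the encoder entries are at most 1. For (ii), a best reply to each message turns
the game into one on the encoder, which has fewer outputs than inputs. -/

/-- `c` is a nonnegative matrix with row sums `q`, column sums `p` and zero diagonal. -/
def IsOffDiagCoupling {ι : Type*} [Fintype ι] (p q : ι → ℝ) (c : ι → ι → ℝ) : Prop :=
  (∀ a b, 0 ≤ c a b) ∧ (∀ a, c a a = 0) ∧ (∀ a, ∑ b, c a b = q a) ∧ ∀ b, ∑ a, c a b = p b

/-! ### Off-diagonal couplings and fractional matchings -/

section Coupling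

variable {ι : Type*} [Fintype ι] [DecidableEq ι]

/-- Tightness at `z` forces a star: `q z` is exactly the mass of `p` off `z`, so row `z` serves all
other columns and every other row goes to column `z`. -/
theorem exists_isOffDiagCoupling_of_tight {p q : ι → ℝ} (hp : ∀ z, 0 ≤ p z) (hq : ∀ z, 0 ≤ q z)
    {t : ℝ} (hpt : ∑ z, p z = t) (hqt : ∑ z, q z = t) {z : ι} (hz : p z + q z = t) :
    ∃ c, IsOffDiagCoupling p q c := by
  have hp' := Finset.sum_erase_eq_sub (f := p) (Finset.mem_univ z)
  have hq' := Finset.sum_erase_eq_sub (f := q) (Finset.mem_univ z)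
  rw [← Finset.filter_ne', Finset.sum_filter] at hp' hq'
  refine ⟨fun a b => if a = z then (if b ≠ z then p b else 0) else if b = z then q a else 0,
    fun a b => ?_, fun a => ?_, fun a => ?_, fun b => ?_⟩
  · dsimp only
    split_ifs <;> simp [hp, hq]
  · dsimp only
    split_ifs <;> simp_all
  · by_cases h : a = z
    · subst h
      simp only [if_true]
      linarith
    · simp [h]
  · by_cases h : b = z
    · subst h
      have : ∀ a, (if a = b then (if b ≠ b then p b else 0) else if b = b then q a else 0)
          = if a ≠ b then q a else 0 := by
        intro a; split_ifs <;> simp_all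
      rw [Finset.sum_congr rfl fun a _ => this a]
      linarith
    · simp [h]

theorem exists_isOffDiagCoupling_of_sub_single {p q : ι → ℝ} {a b : ι} (hab : a ≠ b) {ε : ℝ}
    (hε : 0 ≤ ε)
    (h : ∃ c, IsOffDiagCoupling (p - Pi.single b ε) (q - Pi.single a ε) c) :
    ∃ c, IsOffDiagCoupling p q c := by
  obtain ⟨c, h0, hd, hr, hc⟩ := h
  refine ⟨fun x y => c x y + if x = a ∧ y = b then ε else 0, fun x y => ?_, fun x => ?_,
    fun x => ?_, fun y => ?_⟩
  · have := h0 x y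
    dsimp only
    split_ifs <;> linarith
  · have : ¬ (x = a ∧ x = b) := fun h => hab (h.1.symm.trans h.2)
    simp [hd, this]
  · rw [Finset.sum_add_distrib, hr]
    by_cases h : x = a <;> simp [h]
  · rw [Finset.sum_add_distrib, hc]
    by_cases h : y = b <;> simp [h]

/-- Induction on the number of nonzero entries. Mass is put on one off-diagonal entry `(a, b)` until
`q a` or `p b` is exhausted, or until some other point becomes tight and the star finishes. -/
theorem exists_isOffDiagCoupling {p q : ι → ℝ} (hp : ∀ z, 0 ≤ p z) (hq : ∀ z, 0 ≤ q z)
    {t : ℝ} (hpt : ∑ z, p z = t) (hqt : ∑ z, q z = t) (h : ∀ z, p z + q z ≤ t) :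
    ∃ c, IsOffDiagCoupling p q c := by
  induction hN : (Finset.univ.filter (p · ≠ 0)).card + (Finset.univ.filter (q · ≠ 0)).card
    using Nat.strong_induction_on generalizing p q t with
  | _ N ih =>
  subst hN
  by_cases htight : ∃ z, p z + q z = t
  · obtain ⟨z, hz⟩ := htight
    exact exists_isOffDiagCoupling_of_tight hp hq hpt hqt hz
  push Not at htight
  have hlt : ∀ z, p z + q z < t := fun z => lt_of_le_of_ne (h z) (htight z)
  by_cases hp0 : ∀ z, p z = 0
  · have ht : t = 0 := by rw [← hpt]; simp [hp0]
    refine ⟨0, fun _ _ => le_rfl, fun _ => rfl, fun a => ?_, fun b => by simp [hp0]⟩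
    have := hlt a
    have := hp a
    have := hq a
    linarith
  push Not at hp0
  obtain ⟨b, hb⟩ := hp0
  have hbpos : 0 < p b := lt_of_le_of_ne (hp b) hb.symm
  obtain ⟨a, hab, ha⟩ : ∃ a, a ≠ b ∧ q a ≠ 0 := by
    by_contra! hcon
    have : ∑ z, q z = q b := Fintype.sum_eq_single b hcon
    have := hlt b
    linarith
  have hapos : 0 < q a := lt_of_le_of_ne (hq a) ha.symm
  have hsum : ∀ (f : ι → ℝ) (i : ι) (ε : ℝ), ∑ z, (f - Pi.single i ε : ι → ℝ) z
      = ∑ z, f z - ε := by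
    intro f i ε
    simp [Finset.sum_sub_distrib]
  have hnonneg : ∀ (f : ι → ℝ) (i : ι) (ε : ℝ), (∀ z, 0 ≤ f z) → ε ≤ f i →
      ∀ z, 0 ≤ (f - Pi.single i ε : ι → ℝ) z := by
    intro f i ε hf hi z
    by_cases hz : z = i
    · subst hz; simpa using hi
    · simpa [hz] using hf z
  -- At `a` and `b` the left side drops along with the total, so only the other points constrain
  -- `ε`.
  have hle : ∀ ε : ℝ, (∀ z, z ≠ a → z ≠ b → p z + q z ≤ t - ε) →
      ∀ z, (p - Pi.single b ε : ι → ℝ) z + (q - Pi.single a ε : ι → ℝ) z ≤ t - ε := by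
    intro ε hε z
    have := h z
    by_cases hza : z = a
    · subst hza; simp [hab]; linarith
    by_cases hzb : z = b
    · subst hzb; simp [hza]; linarith
    simpa [hza, hzb] using hε z hza hzb
  have hfilter : ∀ (f : ι → ℝ) (i : ι) (ε : ℝ), f i ≠ 0 →
      Finset.univ.filter ((f - Pi.single i ε : ι → ℝ) · ≠ 0) ⊆ Finset.univ.filter (f · ≠ 0) := by
    intro f i ε hi z
    by_cases hz : z = i
    · subst hz; simp [hi]
    · simp [hz]
  have hssub : ∀ (f : ι → ℝ) (i : ι), f i ≠ 0 →
      Finset.univ.filter ((f - Pi.single i (f i) : ι → ℝ) · ≠ 0) ⊂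
        Finset.univ.filter (f · ≠ 0) := by
    intro f i hi
    refine (Finset.ssubset_iff_of_subset (hfilter f i _ hi)).2 ⟨i, ?_, ?_⟩ <;> simp [hi]
  by_cases hfree : ∀ z, z ≠ a → z ≠ b → p z + q z ≤ t - min (q a) (p b)
  · refine exists_isOffDiagCoupling_of_sub_single hab (ε := min (q a) (p b))
      (le_min (hq a) (hp b)) (ih _ ?_ (hnonneg p b _ hp (min_le_right _ _))
        (hnonneg q a _ hq (min_le_left _ _)) (by rw [hsum, hpt]) (by rw [hsum, hqt])
        (hle _ hfree) rfl)
    rcases min_choice (q a) (p b) with hm | hm <;> rw [hm]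
    · exact add_lt_add_of_le_of_lt (Finset.card_le_card (hfilter p b _ hb))
        (Finset.card_lt_card (hssub q a ha))
    · exact add_lt_add_of_lt_of_le (Finset.card_lt_card (hssub p b hb))
        (Finset.card_le_card (hfilter q a _ ha))
  · push Not at hfree
    obtain ⟨z₀, hz₀a, hz₀b, hz₀⟩ := hfree
    obtain ⟨z, hz, hmax⟩ := Finset.exists_max_image
      (Finset.univ.filter fun z => z ≠ a ∧ z ≠ b) (fun z => p z + q z)
      ⟨z₀, by simp [hz₀a, hz₀b]⟩
    simp only [Finset.mem_filter, Finset.mem_univ, true_and] at hz hmax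
    have hzz := hmax z₀ ⟨hz₀a, hz₀b⟩
    have hεq := min_le_left (q a) (p b)
    have hεp := min_le_right (q a) (p b)
    refine exists_isOffDiagCoupling_of_sub_single hab (ε := t - (p z + q z))
      (by linarith [h z]) (exists_isOffDiagCoupling_of_tight (t := p z + q z) (z := z)
        (hnonneg p b _ hp (by linarith)) (hnonneg q a _ hq (by linarith))
        (by rw [hsum, hpt]; ring) (by rw [hsum, hqt]; ring) (by simp [hz.1, hz.2]))

/-- A fractional matching of the complete graph: every vertex `x` has load at most `v x`, and the
total weight is the smaller of half of the capacity and the capacity outside one vertex. -/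
theorem exists_fractional_matching {v : ι → ℝ} (hv : ∀ x, 0 ≤ v x) :
    ∃ k : ι → ι → ℝ, (∀ a b, 0 ≤ k a b) ∧ (∀ a, k a a = 0) ∧
      (∀ x, ∑ b, k x b + ∑ a, k a x ≤ v x) ∧
      (∑ a, ∑ b, k a b = (∑ x, v x) / 2 ∨ ∃ x, ∑ a, ∑ b, k a b = (∑ x', v x') - v x) := by
  -- Without a dominant vertex, half of an off-diagonal coupling of `u` with itself saturates every
  -- vertex.
  have key : ∀ u : ι → ℝ, (∀ x, 0 ≤ u x) → (∀ x, 2 * u x ≤ ∑ x, u x) →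
      ∃ k : ι → ι → ℝ, (∀ a b, 0 ≤ k a b) ∧ (∀ a, k a a = 0) ∧
        (∀ x, ∑ b, k x b + ∑ a, k a x = u x) ∧ ∑ a, ∑ b, k a b = (∑ x, u x) / 2 := by
    intro u hu h
    obtain ⟨c, h0, hd, hr, hc⟩ := exists_isOffDiagCoupling hu hu rfl rfl
      (fun z => by linarith [h z])
    refine ⟨fun a b => c a b / 2, fun a b => by have := h0 a b; positivity,
      fun a => by simp [hd], fun x => ?_, ?_⟩
    · simp only [← Finset.sum_div, hr, hc]; ring
    · simp only [← Finset.sum_div, hr]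
  by_cases h : ∀ x, 2 * v x ≤ ∑ x, v x
  · obtain ⟨k, h0, hd, hl, ht⟩ := key v hv h
    exact ⟨k, h0, hd, fun x => (hl x).le, Or.inl ht⟩
  push Not at h
  obtain ⟨x₀, hx₀⟩ := h
  have hsum : ∑ x, v x = v x₀ + ∑ x ∈ Finset.univ.erase x₀, v x :=
    (Finset.add_sum_erase _ _ (Finset.mem_univ x₀)).symm
  set r := ∑ x ∈ Finset.univ.erase x₀, v x with hr
  have hr0 : 0 ≤ r := Finset.sum_nonneg fun x _ => hv x
  -- Lowering the dominant capacity to `r`, the sum of the others, makes `key` applicable with total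
  -- weight `r`.
  have hu : ∑ x, Function.update v x₀ r x = 2 * r := by
    rw [Finset.sum_update_of_mem (Finset.mem_univ x₀), Finset.sdiff_singleton_eq_erase, ← hr]
    ring
  obtain ⟨k, h0, hd, hl, ht⟩ := key (Function.update v x₀ r)
    (fun x => by
      by_cases hx : x = x₀
      · subst hx; simpa using hr0
      · simpa [hx] using hv x)
    (fun x => by
      rw [hu]
      by_cases hx : x = x₀
      · subst hx; simp
      · have : v x ≤ r := Finset.single_le_sum (f := v) (fun i _ => hv i) (by simp [hx])
        simpa [hx] using this)
  refine ⟨k, h0, hd, fun x => ?_, Or.inr ⟨x₀, ?_⟩⟩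
  · rw [hl]
    by_cases hx : x = x₀
    · subst hx; simp; linarith
    · simp [hx]
  · rw [ht, hu, hsum]; ring

end Coupling

/-! ### Ambiguous games as scores of guessing functions -/

/-- The score of `P` in the game that guesses `g y` on the outputs `y ∈ S` and gives weight `w` to
every other output. -/
def gameScore {n n' : ℕ} (w : ℝ) (S : Finset (Fin n')) (g : Fin n' → Fin n)
    (P : Matrix (Fin n') (Fin n) ℝ) : ℝ :=
  ∑ y, if y ∈ S then P y (g y) else w * ∑ x, P y x

theorem exists_eq_ite_of_sum_eq_one {ι : Type*} [Fintype ι] [DecidableEq ι] {r : ι → ℝ}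
    (h01 : ∀ x, r x = 0 ∨ r x = 1) (hsum : ∑ x, r x = 1) :
    ∃ a, ∀ x, r x = if x = a then 1 else 0 := by
  have hr0 : ∀ x, 0 ≤ r x := fun x => by rcases h01 x with h | h <;> simp [h]
  obtain ⟨a, -, ha⟩ := Finset.exists_ne_zero_of_sum_ne_zero (hsum ▸ one_ne_zero)
  have ha1 : r a = 1 := (h01 a).resolve_left ha
  refine ⟨a, fun x => ?_⟩
  split_ifs with hx
  · rw [hx, ha1]
  · have h1 := Finset.add_sum_erase Finset.univ r (Finset.mem_univ a)
    have h2 : r x ≤ ∑ i ∈ Finset.univ.erase a, r i :=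
      Finset.single_le_sum (fun i _ => hr0 i) (by simp [hx])
    linarith [hr0 x]

theorem mem_ambiguousPolytope_iff {n n' k d : ℕ} (hn : 0 < n) {P : Matrix (Fin n') (Fin n) ℝ} :
    P ∈ ambiguousPolytope n n' k d ↔ P ∈ channels n n' ∧
      ∀ (S : Finset (Fin n')) (g : Fin n' → Fin n), S.card = k →
        gameScore (1 / ((n : ℝ) - (d : ℝ) + 1)) S g P ≤ d := by
  refine and_congr_right fun _ => ⟨fun h S g hS => ?_, fun h G hG => ?_⟩
  · have := h (Matrix.of fun y x => if y ∈ S then (if x = g y then 1 else 0)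
      else 1 / ((n : ℝ) - (d : ℝ) + 1)) ⟨S, hS, fun y hy => ⟨fun x => ?_, ?_⟩, fun y hy x => ?_⟩
    · refine le_of_eq_of_le ?_ this
      rw [matrixInner, Finset.sum_comm, gameScore]
      refine Finset.sum_congr rfl fun y _ => ?_
      by_cases hy : y ∈ S <;> simp [hy, Finset.mul_sum]
    · simp only [Matrix.of_apply, hy, if_true]
      split_ifs <;> simp
    · simp [hy]
    · simp [hy]
  · obtain ⟨S, hS, h1, h2⟩ := hG
    have : ∀ y, ∃ a, y ∈ S → ∀ x, G y x = if x = a then 1 else 0 := by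
      intro y
      by_cases hy : y ∈ S
      · obtain ⟨a, ha⟩ := exists_eq_ite_of_sum_eq_one (h1 y hy).1 (h1 y hy).2
        exact ⟨a, fun _ => ha⟩
      · exact ⟨⟨0, hn⟩, fun h => absurd h hy⟩
    choose g hg using this
    refine le_of_eq_of_le ?_ (h S g hS)
    rw [matrixInner, Finset.sum_comm, gameScore]
    refine Finset.sum_congr rfl fun y _ => ?_
    by_cases hy : y ∈ S
    · simp [hy, hg y hy]
    · simp [hy, h2 y hy, Finset.mul_sum]

theorem mem_mlPolytope_iff {n n' d : ℕ} (hn : 0 < n) {P : Matrix (Fin n') (Fin n) ℝ} :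
    P ∈ mlPolytope n n' d ↔ P ∈ channels n n' ∧ ∀ g : Fin n' → Fin n, ∑ y, P y (g y) ≤ d := by
  rw [mlPolytope, mem_ambiguousPolytope_iff hn]
  refine and_congr_right fun _ => ⟨fun h g => ?_, fun h S g hS => ?_⟩
  · simpa [gameScore] using h Finset.univ g (by simp)
  · have : S = Finset.univ := by rw [← Finset.card_eq_iff_eq_univ, hS, Fintype.card_fin]
    subst this
    simpa [gameScore] using h g

theorem mem_mlPolytope_iff_sum_iSup {n n' d : ℕ} (hn : 0 < n) {P : Matrix (Fin n') (Fin n) ℝ} :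
    P ∈ mlPolytope n n' d ↔ P ∈ channels n n' ∧ ∑ y, (⨆ x, P y x) ≤ (d : ℝ) := by
  have : Nonempty (Fin n) := ⟨⟨0, hn⟩⟩
  rw [mem_mlPolytope_iff hn]
  refine and_congr_right fun _ => ⟨fun h => ?_, fun h g => ?_⟩
  · have : ∀ y, ∃ a, P y a = ⨆ x, P y x := fun y => exists_eq_ciSup_of_finite
    choose g hg using this
    simpa [hg] using h g
  · exact (Finset.sum_le_sum fun y _ => le_ciSup (Set.finite_range (P y)).bddAbove (g y)).trans h

/-! ### Mixtures and channels that save one message -/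

section Simulation

variable {n n' d : ℕ}

theorem sum_sum_channel {P : Matrix (Fin n') (Fin n) ℝ} (hP : P ∈ channels n n') :
    ∑ y, ∑ x, P y x = n := by
  calc ∑ y, ∑ x, P y x = ∑ x, ∑ y, P y x := Finset.sum_comm
    _ = n := by simp [hP.2]

/-- A mixture of channels that factor through `d` messages lies in the signaling polytope; the
`l`-th component `W l` is given with its weight `q l` included. -/
theorem mem_signalingPolytope_of_sum {ι : Type*} [Fintype ι] {P : Matrix (Fin n') (Fin n) ℝ}
    (hP : P ∈ channels n n') (q : ι → ℝ) (hq : ∀ l, 0 ≤ q l) (hq1 : ∑ l, q l = 1)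
    (W : ι → Matrix (Fin n') (Fin n) ℝ) (hW0 : ∀ l y x, 0 ≤ W l y x)
    (hWq : ∀ l x, ∑ y, W l y x = q l) (hWP : ∀ y x, ∑ l, W l y x = P y x)
    (hfac : ∀ l, (q l)⁻¹ • W l ∈ channels n n' → ∃ T ∈ channels n d, ∃ R ∈ channels d n',
      (q l)⁻¹ • W l = R * T) :
    P ∈ signalingPolytope n n' d := by
  have hch : ∀ l, q l ≠ 0 → (q l)⁻¹ • W l ∈ channels n n' := by
    intro l hl
    refine ⟨fun y x => mul_nonneg (inv_nonneg.2 (hq l)) (hW0 l y x), fun x => ?_⟩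
    simp only [Matrix.smul_apply, smul_eq_mul, ← Finset.mul_sum, hWq]
    exact inv_mul_cancel₀ hl
  obtain ⟨l₀, -, hl₀⟩ := Finset.exists_ne_zero_of_sum_ne_zero (hq1 ▸ one_ne_zero)
  have : ∀ l, ∃ T ∈ channels n d, ∃ R ∈ channels d n', W l = q l • (R * T) := by
    intro l
    -- A component of weight 0 vanishes, so any factors serve; they are borrowed from `l₀`, since
    -- channels to `d` messages need not exist a priori.
    by_cases hl : q l = 0
    · obtain ⟨T, hT, R, hR, -⟩ := hfac l₀ (hch l₀ hl₀)
      refine ⟨T, hT, R, hR, ?_⟩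
      ext y x
      have h0 := hWq l x
      rw [hl, Finset.sum_eq_zero_iff_of_nonneg fun y _ => hW0 l y x] at h0
      simp [hl, h0 y]
    · obtain ⟨T, hT, R, hR, h⟩ := hfac l (hch l hl)
      exact ⟨T, hT, R, hR, by rw [← h, smul_inv_smul₀ hl]⟩
  choose T hT R hR hW using this
  let e := (Fintype.equivFin ι).symm
  refine ⟨hP, Fintype.card ι, q ∘ e, T ∘ e, R ∘ e, fun l => hq _, ?_, fun l => hT _,
    fun l => hR _, fun y x => ?_⟩
  · rw [← hq1]
    exact e.sum_comp q
  · rw [← hWP, ← e.sum_comp]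
    refine Finset.sum_congr rfl fun l _ => ?_
    rw [hW]
    simp [Matrix.mul_apply]

/-- A channel that never outputs `z` needs one message less than it has outputs. -/
theorem exists_factor_of_row_eq_zero {W : Matrix (Fin (d + 1)) (Fin n) ℝ}
    (hW : W ∈ channels n (d + 1)) {z : Fin (d + 1)} (hz : ∀ x, W z x = 0) :
    ∃ T ∈ channels n d, ∃ R ∈ channels d (d + 1), W = R * T := by
  refine ⟨Matrix.of fun m x => W (z.succAbove m) x, ⟨fun _ _ => hW.1 _ _, fun x => ?_⟩,
    Matrix.of fun y m => if y = z.succAbove m then 1 else 0,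
    ⟨fun y m => ?_, fun m => by simp⟩, ?_⟩
  · have := hW.2 x
    rwa [Fin.sum_univ_succAbove _ z, hz, zero_add] at this
  · rw [Matrix.of_apply]
    split_ifs <;> simp
  · ext y x
    rw [Matrix.mul_apply]
    rcases Fin.eq_self_or_eq_succAbove z y with rfl | ⟨m, rfl⟩
    · simp [hz, (Fin.succAbove_ne _ _).symm]
    · simp

/-- A channel with two equal columns needs one message less than it has inputs. -/
theorem exists_factor_of_col_eq {W : Matrix (Fin n') (Fin (d + 1)) ℝ}
    (hW : W ∈ channels (d + 1) n') {a b : Fin (d + 1)} (hab : a ≠ b) (h : ∀ y, W y a = W y b) :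
    ∃ T ∈ channels (d + 1) d, ∃ R ∈ channels d n', W = R * T := by
  have : ∀ x : Fin (d + 1), ∃ m : Fin d, ∀ y, W y (b.succAbove m) = W y x := by
    intro x
    rcases Fin.eq_self_or_eq_succAbove b x with rfl | ⟨m, rfl⟩
    · obtain ⟨m, hm⟩ := Fin.exists_succAbove_eq hab
      exact ⟨m, fun y => by rw [hm, h]⟩
    · exact ⟨m, fun _ => rfl⟩
  choose f hf using this
  refine ⟨Matrix.of fun m x => if m = f x then 1 else 0, ⟨fun m x => ?_, fun x => by simp⟩,
    Matrix.of fun y m => W y (b.succAbove m), ⟨fun _ _ => hW.1 _ _, fun m => hW.2 _⟩, ?_⟩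
  · rw [Matrix.of_apply]
    split_ifs <;> simp
  · ext y x
    simp [Matrix.mul_apply, hf]

end Simulation

/-! ### Simulation with one message fewer than outputs -/

theorem mem_signalingPolytope_of_mem_mlPolytope {n d : ℕ} (hn : 0 < n)
    {P : Matrix (Fin (d + 1)) (Fin n) ℝ} (h : P ∈ mlPolytope n (d + 1) d) :
    P ∈ signalingPolytope n (d + 1) d := by
  have : Nonempty (Fin n) := ⟨⟨0, hn⟩⟩
  obtain ⟨hP, hsup⟩ := (mem_mlPolytope_iff_sum_iSup hn).1 h
  have hle : ∀ y x, P y x ≤ ⨆ x, P y x := fun y x =>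
    le_ciSup (Set.finite_range (P y)).bddAbove x
  have hle1 : ∀ y x, P y x ≤ 1 := fun y x => by
    rw [← hP.2 x]
    exact Finset.single_le_sum (f := fun y => P y x) (fun i _ => hP.1 i x) (Finset.mem_univ y)
  have hv0 : ∀ y, 0 ≤ 1 - ⨆ x, P y x := fun y => sub_nonneg.2 (ciSup_le (hle1 y))
  set s := ∑ y, (1 - ⨆ x, P y x) with hs
  have hs1 : 1 ≤ s := by
    rw [hs, Finset.sum_sub_distrib]
    simp
    linarith
  have hs0 : 0 < s := by linarith
  have hq0 : ∀ y, 0 ≤ (1 - ⨆ x, P y x) / s := fun y => div_nonneg (hv0 y) hs0.le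
  have hq1 : ∑ y, (1 - ⨆ x, P y x) / s = 1 := by
    rw [← Finset.sum_div, ← hs, div_self hs0.ne']
  -- Row `z` of the coupling is the part of column `x` sent while `z` is omitted. Since `s ≥ 1`, the
  -- weight at `y` is at most `1 - P y x`.
  have : ∀ x, ∃ c, IsOffDiagCoupling (fun y => P y x) (fun y => (1 - ⨆ x, P y x) / s) c := by
    intro x
    refine exists_isOffDiagCoupling (fun y => hP.1 y x) hq0 (hP.2 x) hq1 fun y => ?_
    have h1 := div_le_self (hv0 y) hs1
    have h2 := hle y x
    linarith
  choose c hc0 hcd hcr hcc using this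
  refine mem_signalingPolytope_of_sum hP _ hq0 hq1 (fun z => Matrix.of fun y x => c x z y)
    (fun z y x => hc0 x z y) (fun z x => hcr x z) (fun y x => hcc x y) fun z hz => ?_
  exact exists_factor_of_row_eq_zero hz (z := z) fun x => by simp [hcd]

/-! ### Score bounds for simulable channels -/

theorem signalingPolytope_sum_guess_le {n n' m : ℕ} {P : Matrix (Fin n') (Fin n) ℝ}
    (h : P ∈ signalingPolytope n n' m) (g : Fin n' → Fin n) : ∑ y, P y (g y) ≤ m := by
  obtain ⟨-, L, q, T, R, hq, hq1, hT, hR, hP⟩ := h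
  have hT1 : ∀ l k x, T l k x ≤ 1 := fun l k x => by
    rw [← (hT l).2 x]
    exact Finset.single_le_sum (f := fun y => T l y x) (fun i _ => (hT l).1 i x)
      (Finset.mem_univ k)
  calc ∑ y, P y (g y) = ∑ l, q l * ∑ k, ∑ y, R l y k * T l k (g y) := by
        simp only [hP]
        rw [Finset.sum_comm]
        refine Finset.sum_congr rfl fun l _ => ?_
        rw [← Finset.mul_sum, Finset.sum_comm]
    _ ≤ ∑ l, q l * ∑ k, ∑ y, R l y k := by
        gcongr with l _ k _ y _
        · exact hq l
        · exact mul_le_of_le_one_right ((hR l).1 _ _) (hT1 _ _ _)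
    _ = m := by simp [(hR _).2, ← Finset.sum_mul, hq1]

/-- Guessing games with fewer guessing rows than inputs are dominated by pure guessing games. -/
theorem gameScore_half_le {n n' : ℕ} {P : Matrix (Fin n') (Fin n) ℝ} (hP : P ∈ channels n n')
    (hguess : n ≤ n' → ∀ g : Fin n' → Fin n, ∑ y, P y (g y) ≤ (n : ℝ) - 1)
    {S : Finset (Fin n')} (hS : S.card < n) (g : Fin n' → Fin n) :
    gameScore (1 / 2) S g P ≤ (n : ℝ) - 1 := by
  have hmiss : ∀ (S : Finset (Fin n')) (g : Fin n' → Fin n), S.card < n →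
      ∃ x₀, ∀ y ∈ S, g y ≠ x₀ := by
    intro S g hS
    by_contra! hcon
    have : (Finset.univ : Finset (Fin n)) ⊆ S.image g := fun x _ => by
      obtain ⟨y, hy, h⟩ := hcon x
      exact Finset.mem_image.2 ⟨y, hy, h⟩
    have := (Finset.card_le_card this).trans Finset.card_image_le
    simp at this
    omega
  have hpair : ∀ y x₀ x₁, x₀ ≠ x₁ → P y x₀ ≤ ∑ x, P y x - P y x₁ := by
    intro y x₀ x₁ h
    rw [← Finset.add_sum_erase _ _ (Finset.mem_univ x₁), add_sub_cancel_left]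
    exact Finset.single_le_sum (f := P y) (fun i _ => hP.1 y i) (by simp [h])
  have htotal : ∀ x₀, ∑ y, (∑ x, P y x - P y x₀) = (n : ℝ) - 1 := by
    intro x₀
    rw [Finset.sum_sub_distrib, sum_sum_channel hP, hP.2]
  have hfull : ∀ g : Fin n' → Fin n, ∑ y, P y (g y) ≤ (n : ℝ) - 1 := by
    intro g
    by_cases hnn : n ≤ n'
    · exact hguess hnn g
    · obtain ⟨x₁, hx₁⟩ := hmiss Finset.univ g (by simpa using hnn)
      rw [← htotal x₁]
      exact Finset.sum_le_sum fun y hy => hpair y _ _ (hx₁ y hy)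
  -- Twice the score is at most the sum of two scores bounded by `n - 1`: a pure guess completed by
  -- an input `x₀` never guessed on `S`, and the whole of `P` without column `x₀`.
  obtain ⟨x₀, hx₀⟩ := hmiss S g hS
  have h1 := hfull fun y => if y ∈ S then g y else x₀
  have h2 : 2 * gameScore (1 / 2) S g P ≤
      ∑ y, P y (if y ∈ S then g y else x₀) + ∑ y, (∑ x, P y x - P y x₀) := by
    rw [gameScore, Finset.mul_sum, ← Finset.sum_add_distrib]
    refine Finset.sum_le_sum fun y _ => ?_
    by_cases hy : y ∈ S
    · simp only [hy, if_true]
      linarith [hpair y _ _ (hx₀ y hy)]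
    · simp only [hy, if_false]
      linarith
  rw [htotal] at h2
  linarith

/-- Replying to message `k` with a best output `f k` leaves a game on the encoder `T l`. It has at
most `m < n` guessing rows, so `gameScore_half_le` applies. -/
theorem signalingPolytope_gameScore_half_le {n n' m : ℕ} (hn' : 0 < n') (hm : m < n)
    {P : Matrix (Fin n') (Fin n) ℝ} (h : P ∈ signalingPolytope n n' m) (S : Finset (Fin n'))
    (g : Fin n' → Fin n) : gameScore (1 / 2) S g P ≤ (n : ℝ) - 1 := by
  have : Nonempty (Fin n') := ⟨⟨0, hn'⟩⟩
  obtain ⟨-, L, q, T, R, hq, hq1, hT, hR, hP⟩ := h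
  let s : Fin L → Fin m → Fin n' → ℝ := fun l k y =>
    if y ∈ S then T l k (g y) else 1 / 2 * ∑ x, T l k x
  have hbound : ∀ l, ∑ k, ∑ y, R l y k * s l k y ≤ (n : ℝ) - 1 := by
    intro l
    have : ∀ k, ∃ y₀, ∀ y, s l k y ≤ s l k y₀ := fun k => Finite.exists_max (s l k)
    choose f hf using this
    refine le_trans ?_ (gameScore_half_le (hT l) (fun h => absurd hm (not_lt.2 h))
      (S := Finset.univ.filter fun k => f k ∈ S) ?_ (g ∘ f))
    · rw [gameScore]
      refine Finset.sum_le_sum fun k _ => ?_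
      calc ∑ y, R l y k * s l k y ≤ ∑ y, R l y k * s l k (f k) :=
            Finset.sum_le_sum fun y _ => mul_le_mul_of_nonneg_left (hf k y) ((hR l).1 y k)
        _ = s l k (f k) := by rw [← Finset.sum_mul, (hR l).2, one_mul]
        _ = _ := by simp [s]
    · refine lt_of_le_of_lt (Finset.card_le_univ _) (by simpa using hm)
  calc gameScore (1 / 2) S g P = ∑ l, q l * ∑ k, ∑ y, R l y k * s l k y := by
        have : ∀ y, (if y ∈ S then P y (g y) else 1 / 2 * ∑ x, P y x) =
            ∑ l, q l * ∑ k, R l y k * s l k y := by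
          intro y
          by_cases hy : y ∈ S
          · simp [hy, hP, s]
          · simp only [hy, if_false, hP, s]
            rw [Finset.sum_comm, Finset.mul_sum]
            refine Finset.sum_congr rfl fun l _ => ?_
            rw [← Finset.mul_sum, Finset.sum_comm, mul_left_comm, Finset.mul_sum]
            congr 1
            refine Finset.sum_congr rfl fun k _ => ?_
            rw [← Finset.mul_sum]
            ring
        simp only [gameScore, this]
        rw [Finset.sum_comm]
        refine Finset.sum_congr rfl fun l _ => ?_
        rw [← Finset.mul_sum, Finset.sum_comm]
    _ ≤ ∑ l, q l * ((n : ℝ) - 1) :=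
        Finset.sum_le_sum fun l _ => mul_le_mul_of_nonneg_left (hbound l) (hq l)
    _ = (n : ℝ) - 1 := by rw [← Finset.sum_mul, hq1, one_mul]

/-! ### Simulation with one message fewer than inputs -/

theorem sum_incident_of_diag_eq_zero {ι : Type*} [Fintype ι] [DecidableEq ι] {F : ι → ι → ℝ}
    (hF : ∀ a, F a a = 0) (x : ι) :
    ∑ l : ι × ι, (if x = l.1 ∨ x = l.2 then F l.1 l.2 else 0) =
      ∑ b, F x b + ∑ a, F a x := by
  have : ∀ a b, (if x = a ∨ x = b then F a b else 0) =
      (if x = a then F a b else 0) + if x = b then F a b else 0 := by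
    intro a b
    by_cases ha : x = a
    · subst ha
      by_cases hb : x = b
      · subst hb; simp [hF]
      · simp [hb]
    · simp [ha]
  rw [Fintype.sum_prod_type]
  simp only [this, Finset.sum_add_distrib]
  congr 1
  · rw [Finset.sum_comm]; simp
  · simp

/-- If fractional matchings of total weight `1` fit below the rows of a channel, the channel is a
mixture of channels that identify two inputs. -/
theorem mem_signalingPolytope_of_matching {n' d : ℕ} {P : Matrix (Fin n') (Fin (d + 1)) ℝ}
    (hP : P ∈ channels (d + 1) n') (w : Fin n' → Fin (d + 1) → Fin (d + 1) → ℝ)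
    (hw0 : ∀ y a b, 0 ≤ w y a b) (hwd : ∀ y a, w y a a = 0)
    (hload : ∀ y x, ∑ b, w y x b + ∑ a, w y a x ≤ P y x)
    (hw1 : ∑ y, ∑ a, ∑ b, w y a b = 1) : P ∈ signalingPolytope (d + 1) n' d := by
  -- `q` weighs the identified pairs, `r` is the mass left over by the matchings and `ρ` its column
  -- sums. By `hρ`, `ρ x` is the `q`-weight of the pairs avoiding `x`, so distributing `r y x` over
  -- these in proportion to `q` restores `P`.
  let q : Fin (d + 1) × Fin (d + 1) → ℝ := fun l => ∑ y, w y l.1 l.2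
  let r : Fin n' → Fin (d + 1) → ℝ := fun y x => P y x - (∑ b, w y x b + ∑ a, w y a x)
  let ρ : Fin (d + 1) → ℝ := fun x => ∑ y, r y x
  have hq0 : ∀ l, 0 ≤ q l := fun l => Finset.sum_nonneg fun y _ => hw0 _ _ _
  have hr0 : ∀ y x, 0 ≤ r y x := fun y x => sub_nonneg.2 (hload y x)
  have hq1 : ∑ l, q l = 1 := by
    rw [Finset.sum_comm, ← hw1]
    exact Finset.sum_congr rfl fun y _ => Fintype.sum_prod_type _
  have hρ : ∀ x, ∑ l : Fin (d + 1) × Fin (d + 1),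
      (if x = l.1 ∨ x = l.2 then 0 else q l) = ρ x := by
    intro x
    have h1 := sum_incident_of_diag_eq_zero (F := fun a b => q (a, b))
      (fun a => by simp [q, hwd]) x
    have h2 : ∑ l : Fin (d + 1) × Fin (d + 1), (if x = l.1 ∨ x = l.2 then 0 else q l) +
        ∑ l : Fin (d + 1) × Fin (d + 1), (if x = l.1 ∨ x = l.2 then q l else 0) = 1 := by
      rw [← hq1, ← Finset.sum_add_distrib]
      exact Finset.sum_congr rfl fun l _ => by split_ifs <;> simp
    have h3 : ρ x = 1 - (∑ b, q (x, b) + ∑ a, q (a, x)) := by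
      simp only [ρ, r, q]
      rw [Finset.sum_sub_distrib, hP.2, Finset.sum_add_distrib, Finset.sum_comm,
        Finset.sum_comm (f := fun y a => w y a x)]
    linarith
  have hqρ : ∀ (l : Fin (d + 1) × Fin (d + 1)) x, ¬ (x = l.1 ∨ x = l.2) → q l ≤ ρ x := by
    intro l x hx
    rw [← hρ x]
    refine le_of_eq_of_le ?_ (Finset.single_le_sum
      (f := fun l : Fin (d + 1) × Fin (d + 1) => if x = l.1 ∨ x = l.2 then 0 else q l)
      (fun l _ => ?_) (Finset.mem_univ l))
    · simp [hx]
    · split_ifs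
      exacts [le_rfl, hq0 l]
  have hρ0 : ∀ x, 0 ≤ ρ x := fun x => Finset.sum_nonneg fun y _ => hr0 y x
  refine mem_signalingPolytope_of_sum hP q hq0 hq1
    (fun l => Matrix.of fun y x => if x = l.1 ∨ x = l.2 then w y l.1 l.2 else q l * (r y x / ρ x))
    (fun l y x => ?_) (fun l x => ?_) (fun y x => ?_) fun l hl => ?_
  · rw [Matrix.of_apply]
    split_ifs
    exacts [hw0 _ _ _, mul_nonneg (hq0 l) (div_nonneg (hr0 y x) (hρ0 x))]
  · by_cases hx : x = l.1 ∨ x = l.2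
    · simp only [Matrix.of_apply, hx, if_true]
      rfl
    · simp only [Matrix.of_apply, hx, if_false]
      rw [← Finset.mul_sum, ← Finset.sum_div]
      -- If `ρ x = 0`, every pair avoiding `x` has weight 0, so the zero column produced by division
      -- by zero is the right one.
      by_cases h0 : ρ x = 0
      · have : q l = 0 := le_antisymm (h0 ▸ hqρ l x hx) (hq0 l)
        simp [this]
      · rw [show ∑ y, r y x = ρ x from rfl, div_self h0, mul_one]
  · have h1 := sum_incident_of_diag_eq_zero (hwd y) x
    have h2 : ∑ l : Fin (d + 1) × Fin (d + 1), (if x = l.1 ∨ x = l.2 then w y l.1 l.2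
        else q l * (r y x / ρ x)) =
        ∑ l : Fin (d + 1) × Fin (d + 1), (if x = l.1 ∨ x = l.2 then w y l.1 l.2 else 0) +
        (∑ l : Fin (d + 1) × Fin (d + 1), if x = l.1 ∨ x = l.2 then 0 else q l) *
          (r y x / ρ x) := by
      rw [Finset.sum_mul, ← Finset.sum_add_distrib]
      exact Finset.sum_congr rfl fun l _ => by split_ifs <;> simp
    have h3 : ρ x * (r y x / ρ x) = r y x := by
      by_cases h0 : ρ x = 0
      · have := (Finset.sum_eq_zero_iff_of_nonneg fun y _ => hr0 y x).1 h0 y (Finset.mem_univ y)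
        simp [this]
      · exact mul_div_cancel₀ _ h0
    simp only [Matrix.of_apply]
    rw [h2, h1, hρ, h3]
    simp [r]
  · by_cases hab : l.1 = l.2
    · have hq : q l = 0 := by simp [q, hab, hwd]
      have := hl.2 0
      simp [hq] at this
    · exact exists_factor_of_col_eq hl hab fun y => by simp

/-- The matchings pick their own game: guess `g y` where the weight is the row sum minus one entry,
and stay ambiguous elsewhere. Their total weight `s` is `d + 1` minus its score, hence at least 1,
and can be scaled to 1. -/
theorem mem_signalingPolytope_of_gameScore_half_le {n' d : ℕ}
    {P : Matrix (Fin n') (Fin (d + 1)) ℝ} (hP : P ∈ channels (d + 1) n')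
    (h : ∀ S g, gameScore (1 / 2) S g P ≤ d) : P ∈ signalingPolytope (d + 1) n' d := by
  have := fun y => exists_fractional_matching (hP.1 y)
  choose k hk0 hkd hkl hkt using this
  have : ∀ y, ∃ x, ∑ a, ∑ b, k y a b = (∑ x, P y x) / 2 ∨
      ∑ a, ∑ b, k y a b = ∑ x, P y x - P y x := by
    intro y
    rcases hkt y with h | ⟨x, h⟩
    exacts [⟨0, Or.inl h⟩, ⟨x, Or.inr h⟩]
  choose g hg using this
  classical
  set s := ∑ y, ∑ a, ∑ b, k y a b with hs
  have hs1 : 1 ≤ s := by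
    have h1 := h (Finset.univ.filter fun y => ∑ a, ∑ b, k y a b = ∑ x, P y x - P y (g y)) g
    have h2 : s = ∑ y, ∑ x, P y x - gameScore (1 / 2)
        (Finset.univ.filter fun y => ∑ a, ∑ b, k y a b = ∑ x, P y x - P y (g y)) g P := by
      rw [gameScore, ← Finset.sum_sub_distrib]
      refine Finset.sum_congr rfl fun y _ => ?_
      by_cases hy : ∑ a, ∑ b, k y a b = ∑ x, P y x - P y (g y)
      · rw [if_pos (by simpa using hy), hy]
      · rw [if_neg (by simpa using hy), (hg y).resolve_right hy]
        ring
    rw [sum_sum_channel hP] at h2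
    push_cast at h2
    linarith
  have hs0 : 0 < s := by linarith
  refine mem_signalingPolytope_of_matching hP (fun y a b => k y a b / s)
    (fun y a b => div_nonneg (hk0 y a b) hs0.le) (fun y a => by simp [hkd]) (fun y x => ?_) ?_
  · rw [← Finset.sum_div, ← Finset.sum_div, ← add_div]
    exact (div_le_self (add_nonneg (Finset.sum_nonneg fun b _ => hk0 _ _ _)
      (Finset.sum_nonneg fun a _ => hk0 _ _ _)) hs1).trans (hkl y x)
  · simp only [← Finset.sum_div]
    exact div_self hs0.ne'

theorem mem_signalingPolytope_of_forall_mem_ambiguousPolytope {n' d : ℕ}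
    {P : Matrix (Fin n') (Fin (d + 1)) ℝ} (hP : P ∈ channels (d + 1) n')
    (h : ∀ k, d + 1 ≤ k → k ≤ n' → P ∈ ambiguousPolytope (d + 1) n' k d) :
    P ∈ signalingPolytope (d + 1) n' d := by
  refine mem_signalingPolytope_of_gameScore_half_le hP fun S g => ?_
  by_cases hS : d + 1 ≤ S.card
  · have := ((mem_ambiguousPolytope_iff d.succ_pos).1
      (h S.card hS (by simpa using S.card_le_univ))).2 S g rfl
    convert this using 2
    push_cast
    norm_num
  -- Below `n` guessing rows only the pure guessing bound `k = n'` is used, and only when `n ≤ n'`.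
  · have := gameScore_half_le hP (fun hn g => ?_) (not_le.1 hS) g
    · simpa using this
    · simpa using ((mem_mlPolytope_iff d.succ_pos).1 (h n' hn le_rfl)).2 g

theorem mem_ambiguousPolytope_of_mem_signalingPolytope {n' d m : ℕ} (hn' : 0 < n')
    (hm : m < d + 1) {P : Matrix (Fin n') (Fin (d + 1)) ℝ}
    (h : P ∈ signalingPolytope (d + 1) n' m) (k : ℕ) :
    P ∈ ambiguousPolytope (d + 1) n' k d := by
  refine (mem_ambiguousPolytope_iff d.succ_pos).2 ⟨h.1, fun S g _ => ?_⟩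
  have := signalingPolytope_gameScore_half_le hn' hm h S g
  convert this using 2
  · push_cast
    norm_num
  · simp

theorem mem_mlPolytope_of_mem_signalingPolytope {n n' d m : ℕ} (hn : 0 < n) (hm : m ≤ d)
    {P : Matrix (Fin n') (Fin n) ℝ} (h : P ∈ signalingPolytope n n' m) :
    P ∈ mlPolytope n n' d :=
  (mem_mlPolytope_iff hn).2 ⟨h.1, fun g =>
    (signalingPolytope_sum_guess_le h g).trans (Nat.cast_le.2 hm)⟩

theorem theorem1 (n n' d : ℕ) (hn : 0 < n) (hn' : 0 < n') (hd : 0 < d) :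
    (d + 1 = n' →
      signalingPolytope n n' d = mlPolytope n n' d ∧
      mlPolytope n n' d = {P | P ∈ channels n n' ∧ ∑ y, (⨆ x, P y x) ≤ (d : ℝ)} ∧
      ∀ P ∈ channels n n',
        (∃ m, 0 < m ∧ m < n' ∧ P ∈ signalingPolytope n n' m) ↔ P ∈ mlPolytope n n' d) ∧
    (d + 1 = n →
      signalingPolytope n n' d =
        channels n n' ∩ ⋂ k ∈ Set.Icc n n', ambiguousPolytope n n' k d ∧
      ∀ P ∈ channels n n',
        (∃ m, 0 < m ∧ m < n ∧ P ∈ signalingPolytope n n' m) ↔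
          ∀ k, n ≤ k → k ≤ n' → P ∈ ambiguousPolytope n n' k d) := by
  refine ⟨?_, ?_⟩
  · rintro rfl
    refine ⟨?_, ?_, fun P _ => ⟨?_, fun h => ?_⟩⟩
    · exact Set.Subset.antisymm (fun P h => mem_mlPolytope_of_mem_signalingPolytope hn le_rfl h)
        fun P h => mem_signalingPolytope_of_mem_mlPolytope hn h
    · ext P
      exact mem_mlPolytope_iff_sum_iSup hn
    · rintro ⟨m, -, hm, h⟩
      exact mem_mlPolytope_of_mem_signalingPolytope hn (Nat.lt_succ_iff.1 hm) h
    · exact ⟨d, hd, d.lt_succ_self, mem_signalingPolytope_of_mem_mlPolytope hn h⟩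
  · rintro rfl
    refine ⟨Set.Subset.antisymm (fun P h => ⟨h.1, ?_⟩) fun P h => ?_,
      fun P hP => ⟨?_, fun h => ?_⟩⟩
    · exact Set.mem_iInter₂.2 fun k _ =>
        mem_ambiguousPolytope_of_mem_signalingPolytope hn' d.lt_succ_self h k
    · exact mem_signalingPolytope_of_forall_mem_ambiguousPolytope h.1 fun k h1 h2 =>
        Set.mem_iInter₂.1 h.2 k ⟨h1, h2⟩
    · rintro ⟨m, -, hm, h⟩ k - -
      exact mem_ambiguousPolytope_of_mem_signalingPolytope hn' hm h k
    · exact ⟨d, hd, d.lt_succ_self,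
        mem_signalingPolytope_of_forall_mem_ambiguousPolytope hP h⟩
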